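/- A \emph{dagger category} is a category with an involutive, identity-on-objects contravariant functor $\dagger$. A \emph{dagger idempotent} is an endomorphism $p$ with $p^\dagger=p=p\circ p$; a dagger idempotent $p\colon X\to X$ \emph{dagger splits} if there is $f\colon X\to Y$ with $p=f^\dagger\circ f$ and $f\circ f^\dagger=\mathrm{id}_Y$. Dagger categories $\mathbf C,\mathbf D$ are \emph{dagger equivalent} if there are dagger-preserving functors $F\colon\mathbf C\to\mathbf D$ and $G\colon\mathbf D\to\mathbf C$ and natural isomorphisms $G\circ F\cong\mathrm{id}_{\mathbf C}$, $F\circ G\cong\mathrm{id}_{\mathbf D}$ with unitary components. Let $\mathrm{CP}^*[\mathbf{Rel}]$ be the dagger category whose objects are small groupoids and whose morphisms $\mathbf G\to\mathbf H$ are the relations $R\subseteq \mathrm{Mor}(\mathbf G)\times\mathrm{Mor}(\mathbf H)$ such that $g\,R\,h$ implies $g^{-1}\,R\,h^{-1}$ and $\mathrm{id}_{\mathrm{dom}(g)}\,R\,\mathrm{id}_{\mathrm{dom}(h)}$. Let $\mathrm{CPM}[\mathbf{Rel}]$ be the dagger category whose objects are sets and whose morphisms $X\to Y$ are the completely positive relations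 $R\subseteq (X\times X)\times(Y\times Y)$, i.e. those for which there are a set $C$ and a relation $g\subseteq X\times(C\times Y)$ such that $(x,x')\,R\,(y,y')$ if and only if $x\,g\,(c,y)$ and $x'\,g\,(c,y')$ for some $c\in C$. In both, composition is composition of relations and the dagger is the converse relation. For a dagger category $\mathbf C$, let $\mathrm{Split}^\dagger[\mathbf C]$ have as objects the pairs $(X,p)$ with $p$ a dagger idempotent on $X$ in $\mathbf C$, and as morphisms $(X,p)\to(Y,q)$ the morphisms $f\colon X\to Y$ with $f=q\circ f\circ p$, with the composition and dagger of $\mathbf C$ and with $p$ as the identity of $(X,p)$. \textbf{Theorem.} The dagger categories $\mathrm{CP}^*[\mathbf{Rel}]$ and $\mathrm{Split}^\dagger[\mathrm{CPM}[\mathbf{Rel}]]$ are not dagger equivalent. Moreover, let $\mathbf G$ be the connected groupoid with three objects $a,b,c$ and exactly one morphism between any two of them (nine morphisms in total), and let $h\colon a\to c$. Then $R=\{(x,x)\mid x\in\mathrm{Mor}(\mathbf G)\setminus\{h,h^{-1}\}\}$ is a dagger idempotent on $\mathbf G$ in $\mathrm{CP}^*[\mathbf{Rel}]$ that does not dagger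 split in $\mathrm{CP}^*[\mathbf{Rel}]$. -/

import Mathlib

open CategoryTheory

universe v v' u u'

/-! ### Dagger categories -/

/-- A dagger on a category: an identity-on-objects involutive contravariant functor. -/
class DaggerCategory (C : Type u) [Category.{v} C] where
  /-- The dagger (adjoint) of a morphism. -/
  dag : ∀ {X Y : C}, (X ⟶ Y) → (Y ⟶ X)
  dag_id : ∀ X : C, dag (𝟙 X) = 𝟙 X
  dag_comp : ∀ {X Y Z : C} (f : X ⟶ Y) (g : Y ⟶ Z), dag (f ≫ g) = dag g ≫ dag f
  dag_dag : ∀ {X Y : C} (f : X ⟶ Y), dag (dag f) = f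

namespace DaggerCategory

variable {C : Type u} [Category.{v} C] [DaggerCategory C]

/-- A dagger idempotent (projection) is an endomorphism `p` with `p† = p = p ∘ p`. -/
def IsDaggerIdempotent {X : C} (p : X ⟶ X) : Prop :=
  dag p = p ∧ p ≫ p = p

/-- `p : X ⟶ X` dagger splits if there is `f : X ⟶ Y` with `p = f† ∘ f` and `f ∘ f† = 𝟙 Y`. -/
def DaggerSplits {X : C} (p : X ⟶ X) : Prop :=
  ∃ (Y : C) (f : X ⟶ Y), f ≫ dag f = p ∧ dag f ≫ f = 𝟙 Y

/-- A morphism `f` is unitary if it is invertible and its inverse is `f†`. -/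
def IsUnitary {X Y : C} (f : X ⟶ Y) : Prop :=
  f ≫ dag f = 𝟙 X ∧ dag f ≫ f = 𝟙 Y

/-- A dagger functor is a functor that preserves daggers. -/
def IsDaggerFunctor {D : Type u'} [Category.{v'} D] [DaggerCategory D] (F : C ⥤ D) : Prop :=
  ∀ {X Y : C} (f : X ⟶ Y), F.map (dag f) = dag (F.map f)

end DaggerCategory

open DaggerCategory in
/-- Dagger categories `C` and `D` are dagger equivalent if there are dagger functors
`F : C ⥤ D` and `G : D ⥤ C` and natural isomorphisms `G ∘ F ≅ id` and `F ∘ G ≅ id`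
all of whose components are unitary. -/
def DaggerEquivalent (C : Type u) [Category.{v} C] [DaggerCategory C]
    (D : Type u') [Category.{v'} D] [DaggerCategory D] : Prop :=
  ∃ (F : C ⥤ D) (G : D ⥤ C) (η : F ⋙ G ≅ 𝟭 C) (ε : G ⋙ F ≅ 𝟭 D),
    IsDaggerFunctor F ∧ IsDaggerFunctor G ∧
      (∀ X : C, IsUnitary (η.hom.app X)) ∧ (∀ Y : D, IsUnitary (ε.hom.app Y))

/-! ### Splitting all dagger idempotents -/

/-- Objects of `Split†[C]`: pairs `(X, p)` with `p` a dagger idempotent on the object `X`. -/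
structure DaggerSplit (C : Type u) [Category.{v} C] [DaggerCategory C] where
  /-- The underlying object. -/
  X : C
  /-- The dagger idempotent. -/
  p : X ⟶ X
  isDaggerIdempotent : DaggerCategory.IsDaggerIdempotent p

namespace DaggerSplit

variable {C : Type u} [Category.{v} C] [DaggerCategory C]

/-- Morphisms `(X, p) ⟶ (Y, q)` are morphisms `f : X ⟶ Y` of `C` with `f = q ∘ f ∘ p`. -/
@[ext]
structure Hom (P Q : DaggerSplit C) where
  /-- The underlying morphism. -/
  f : P.X ⟶ Q.X
  comm : f = P.p ≫ f ≫ Q.p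

theorem Hom.p_comp {P Q : DaggerSplit C} (f : Hom P Q) : P.p ≫ f.f = f.f := by
  rw [f.comm, ← Category.assoc, P.isDaggerIdempotent.2]

theorem Hom.comp_p {P Q : DaggerSplit C} (f : Hom P Q) : f.f ≫ Q.p = f.f := by
  rw [f.comm, Category.assoc, Category.assoc, Q.isDaggerIdempotent.2]

instance : Category.{v} (DaggerSplit C) where
  Hom P Q := Hom P Q
  id P := ⟨P.p, by rw [P.isDaggerIdempotent.2, P.isDaggerIdempotent.2]⟩
  comp f g := ⟨f.f ≫ g.f, by
    rw [Category.assoc, g.comp_p, ← Category.assoc, f.p_comp]⟩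
  id_comp f := Hom.ext f.p_comp
  comp_id f := Hom.ext f.comp_p
  assoc f g h := Hom.ext (Category.assoc f.f g.f h.f)

instance : DaggerCategory (DaggerSplit C) where
  dag {P Q} f := ⟨DaggerCategory.dag f.f, by
    conv_lhs => rw [f.comm]
    rw [DaggerCategory.dag_comp, DaggerCategory.dag_comp, Category.assoc,
      P.isDaggerIdempotent.1, Q.isDaggerIdempotent.1]⟩
  dag_id P := Hom.ext P.isDaggerIdempotent.1
  dag_comp f g := Hom.ext (DaggerCategory.dag_comp f.f g.f)
  dag_dag f := Hom.ext (DaggerCategory.dag_dag f.f)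

end DaggerSplit

/-! ### The category `CPM[Rel]` -/

/-- Complete positivity in `Rel`: since sets are self-dual in `Rel`, a relation
`R : X × X → Y × Y` is completely positive if, for some set `C` and some relation
`g : X → C × Y`, it is the composite of `g × g` with the contraction of the two
copies of `C`. -/
def IsCompletelyPositive {X Y : Type u} (R : SetRel (X × X) (Y × Y)) : Prop :=
  ∃ (C : Type u) (g : SetRel X (C × Y)), ∀ (x x' : X) (y y' : Y),
    ((x, x'), (y, y')) ∈ R ↔ ∃ c : C, (x, (c, y)) ∈ g ∧ (x', (c, y')) ∈ g

/-- The elementary form of complete positivity in `Rel`. -/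
theorem isCompletelyPositive_iff {X Y : Type u} (R : SetRel (X × X) (Y × Y)) :
    IsCompletelyPositive R ↔ ∀ (x x' : X) (y y' : Y), ((x, x'), (y, y')) ∈ R →
      ((x', x), (y', y)) ∈ R ∧ ((x, x), (y, y)) ∈ R := by
  constructor
  · rintro ⟨C, g, hg⟩ x x' y y' h
    obtain ⟨c, h₁, h₂⟩ := (hg _ _ _ _).1 h
    exact ⟨(hg _ _ _ _).2 ⟨c, h₂, h₁⟩, (hg _ _ _ _).2 ⟨c, h₁, h₁⟩⟩
  · intro H
    refine ⟨{t : (X × X) × (Y × Y) // t ∈ R},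
      {s | (s.1 = s.2.1.1.1.1 ∧ s.2.2 = s.2.1.1.2.1) ∨
        (s.1 = s.2.1.1.1.2 ∧ s.2.2 = s.2.1.1.2.2)}, fun x x' y y' => ⟨fun h => ?_, ?_⟩⟩
    · exact ⟨⟨_, h⟩, Or.inl ⟨rfl, rfl⟩, Or.inr ⟨rfl, rfl⟩⟩
    · rintro ⟨⟨⟨⟨a, a'⟩, ⟨b, b'⟩⟩, h⟩, h₁, h₂⟩
      have h' := H _ _ _ _ h
      have h'' := H _ _ _ _ h'.1
      rcases h₁ with ⟨h₁, h₁'⟩ | ⟨h₁, h₁'⟩ <;> rcases h₂ with ⟨h₂, h₂'⟩ | ⟨h₂, h₂'⟩ <;>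
        simp only at h₁ h₁' h₂ h₂' <;> subst h₁ h₁' h₂ h₂'
      · exact h'.2
      · exact h
      · exact h'.1
      · exact h''.2

/-- Objects of `CPM[Rel]`: sets. -/
structure CPMRel : Type (u + 1) where
  /-- The underlying set. -/
  carrier : Type u

namespace CPMRel

/-- Morphisms `X ⟶ Y` of `CPM[Rel]`: completely positive relations `X × X → Y × Y`. -/
@[ext]
structure Hom (X Y : CPMRel.{u}) : Type u where
  /-- The underlying relation. -/
  rel : SetRel (X.carrier × X.carrier) (Y.carrier × Y.carrier)
  isCompletelyPositive : IsCompletelyPositive rel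

instance : Category.{u} CPMRel.{u} where
  Hom X Y := Hom X Y
  id X := ⟨SetRel.id, by
    rw [isCompletelyPositive_iff]
    simp only [SetRel.mem_id, Prod.mk.injEq]
    tauto⟩
  comp R S := ⟨R.rel.comp S.rel, by
    rw [isCompletelyPositive_iff]
    rintro x x' z z' ⟨⟨y, y'⟩, h₁, h₂⟩
    have h₃ := (isCompletelyPositive_iff _).1 R.isCompletelyPositive _ _ _ _ h₁
    have h₄ := (isCompletelyPositive_iff _).1 S.isCompletelyPositive _ _ _ _ h₂
    exact ⟨⟨(y', y), h₃.1, h₄.1⟩, ⟨(y, y), h₃.2, h₄.2⟩⟩⟩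
  id_comp R := Hom.ext (SetRel.id_comp R.rel)
  comp_id R := Hom.ext (SetRel.comp_id R.rel)
  assoc R S T := Hom.ext (SetRel.comp_assoc R.rel S.rel T.rel)

/-- The dagger is relational converse. -/
instance : DaggerCategory CPMRel.{u} where
  dag R := ⟨R.rel.inv, by
    rw [isCompletelyPositive_iff]
    intro y y' x x' h
    exact (isCompletelyPositive_iff _).1 R.isCompletelyPositive _ _ _ _ h⟩
  dag_id _ := Hom.ext SetRel.inv_id
  dag_comp R S := Hom.ext (SetRel.inv_comp R.rel S.rel)
  dag_dag _ := Hom.ext SetRel.inv_inv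

end CPMRel

/-! ### The category `CP*[Rel]` -/

/-- The set of all morphisms of a small groupoid. -/
structure GroupoidMor (G : Type u) [Groupoid.{u} G] : Type u where
  /-- The domain. -/
  dom : G
  /-- The codomain. -/
  cod : G
  /-- The morphism. -/
  hom : dom ⟶ cod

namespace GroupoidMor

variable {G : Type u} [Groupoid.{u} G]

/-- The inverse morphism `g⁻¹`. -/
def inv (g : GroupoidMor G) : GroupoidMor G := ⟨g.cod, g.dom, Groupoid.inv g.hom⟩

/-- The identity morphism on the domain of `g`. -/
def idDom (g : GroupoidMor G) : GroupoidMor G := ⟨g.dom, g.dom, 𝟙 g.dom⟩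

end GroupoidMor

/-- A relation between the morphism sets of two groupoids respects inverses if `g R h` implies
`g⁻¹ R h⁻¹` and `id_(dom g) R id_(dom h)`. -/
def RespectsInverses {G H : Type u} [Groupoid.{u} G] [Groupoid.{u} H]
    (R : SetRel (GroupoidMor G) (GroupoidMor H)) : Prop :=
  ∀ (g : GroupoidMor G) (h : GroupoidMor H), (g, h) ∈ R →
    (g.inv, h.inv) ∈ R ∧ (g.idDom, h.idDom) ∈ R

/-- The multiplication of a groupoid as a ternary relation on its morphisms: `IsMul a g b` says
that the composite `a ∘ g` is defined and equals `b`. -/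
inductive GroupoidMor.IsMul {G : Type u} [Groupoid.{u} G] :
    GroupoidMor G → GroupoidMor G → GroupoidMor G → Prop
  | intro {x y z : G} (g : x ⟶ y) (a : y ⟶ z) : IsMul ⟨y, z, a⟩ ⟨x, y, g⟩ ⟨x, z, g ≫ a⟩

/-- Respecting inverses is the complete positivity condition of the CP*-construction for the
multiplications of `G` and `H`: the relation that `R` induces between pairs `(a, b)` with
`a⁻¹ b = g` and pairs `(c, d)` with `c⁻¹ d = h` is completely positive. -/
theorem respectsInverses_iff {G H : Type u} [Groupoid.{u} G] [Groupoid.{u} H]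
    (R : SetRel (GroupoidMor G) (GroupoidMor H)) :
    RespectsInverses R ↔ IsCompletelyPositive
      {s : (GroupoidMor G × GroupoidMor G) × (GroupoidMor H × GroupoidMor H) |
        ∃ g h, GroupoidMor.IsMul s.1.1 g s.1.2 ∧ (g, h) ∈ R ∧
          GroupoidMor.IsMul s.2.1 h s.2.2} := by
  have key : ∀ {K : Type u} [Groupoid.{u} K] {a g b : GroupoidMor K},
      a.IsMul g b → b.IsMul g.inv a ∧ a.IsMul g.inv.idDom a := by
    rintro K _ _ _ _ ⟨g, a⟩
    refine ⟨?_, ?_⟩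
    · have := GroupoidMor.IsMul.intro (Groupoid.inv g) (g ≫ a)
      rwa [← Category.assoc, Groupoid.inv_comp, Category.id_comp] at this
    · have := GroupoidMor.IsMul.intro (𝟙 _) a
      rwa [Category.id_comp] at this
  have unit : ∀ {K : Type u} [Groupoid.{u} K] (g : GroupoidMor K), g.inv.idDom.IsMul g g := by
    rintro K _ ⟨x, y, g⟩
    have := GroupoidMor.IsMul.intro g (𝟙 y)
    rwa [Category.comp_id] at this
  have cancel : ∀ {K : Type u} [Groupoid.{u} K] {a g g' b : GroupoidMor K},
      a.IsMul g b → a.IsMul g' b → g = g' := by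
    rintro K _ _ _ ⟨x', y', g'⟩ _ ⟨g, a⟩ h
    generalize hb : (⟨_, _, g ≫ a⟩ : GroupoidMor K) = b at h
    cases h
    injection hb with h₁ h₂ h₃
    subst h₁
    rw [heq_eq_eq] at h₃
    rw [← Category.comp_id g, ← Category.comp_id g', ← Groupoid.comp_inv a,
      ← Category.assoc, ← Category.assoc, h₃]
  have invinv : ∀ {K : Type u} [Groupoid.{u} K] (g : GroupoidMor K), g.inv.inv = g := by
    rintro K _ ⟨x, y, g⟩
    simp [GroupoidMor.inv]
  rw [isCompletelyPositive_iff]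
  constructor
  · rintro hR a b c d ⟨g, h, h₁, h₂, h₃⟩
    have hi := (hR _ _ h₂).1
    exact ⟨⟨g.inv, h.inv, (key h₁).1, hi, (key h₃).1⟩,
      ⟨_, _, (key h₁).2, (hR _ _ hi).2, (key h₃).2⟩⟩
  · intro H
    have step : ∀ g h, (g, h) ∈ R → (g.inv, h.inv) ∈ R ∧ (g.inv.idDom, h.inv.idDom) ∈ R := by
      intro g h hgh
      obtain ⟨⟨g₁, h₁, e₁, e₂, e₃⟩, ⟨g₂, h₂, e₄, e₅, e₆⟩⟩ :=
        H _ _ _ _ ⟨g, h, unit g, hgh, unit h⟩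
      rw [cancel e₁ (key (unit g)).1, cancel e₃ (key (unit h)).1] at e₂
      rw [cancel e₄ (key (unit g)).2, cancel e₆ (key (unit h)).2] at e₅
      exact ⟨e₂, e₅⟩
    intro g h hgh
    have h₁ := (step g h hgh).1
    have h₂ := (step _ _ h₁).2
    rw [invinv, invinv] at h₂
    exact ⟨h₁, h₂⟩

/-- Objects of `CP*[Rel]`: small groupoids. -/
structure CPStarRel : Type (u + 1) where
  /-- The set of objects of the groupoid. -/
  carrier : Type u
  [groupoid : Groupoid.{u} carrier]

namespace CPStarRel

attribute [instance] CPStarRel.groupoid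

/-- Morphisms `G ⟶ H` of `CP*[Rel]`: relations between the sets of all morphisms of `G` and of
`H` that respect inverses. -/
@[ext]
structure Hom (G H : CPStarRel.{u}) : Type u where
  /-- The underlying relation. -/
  rel : SetRel (GroupoidMor G.carrier) (GroupoidMor H.carrier)
  respectsInverses : RespectsInverses rel

instance : Category.{u} CPStarRel.{u} where
  Hom G H := Hom G H
  id G := ⟨SetRel.id, by
    intro g h e
    rw [SetRel.mem_id] at e
    subst e
    exact ⟨rfl, rfl⟩⟩
  comp R S := ⟨R.rel.comp S.rel, by
    rintro g k ⟨h, h₁, h₂⟩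
    have h₃ := R.respectsInverses _ _ h₁
    have h₄ := S.respectsInverses _ _ h₂
    exact ⟨⟨_, h₃.1, h₄.1⟩, ⟨_, h₃.2, h₄.2⟩⟩⟩
  id_comp R := Hom.ext (SetRel.id_comp R.rel)
  comp_id R := Hom.ext (SetRel.comp_id R.rel)
  assoc R S T := Hom.ext (SetRel.comp_assoc R.rel S.rel T.rel)

/-- The dagger is relational converse. -/
instance : DaggerCategory CPStarRel.{u} where
  dag R := ⟨R.rel.inv, fun _ _ e => R.respectsInverses _ _ e⟩
  dag_id _ := Hom.ext SetRel.inv_id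
  dag_comp R S := Hom.ext (SetRel.inv_comp R.rel S.rel)
  dag_dag _ := Hom.ext SetRel.inv_inv

end CPStarRel

/-! ### The witness -/

/-- The three objects `a`, `b`, `c` of the witnessing groupoid. -/
inductive ThreeObj : Type u
  | a
  | b
  | c

/-- Exactly one morphism between any two of the three objects. -/
instance : Groupoid.{u} ThreeObj.{u} where
  Hom _ _ := PUnit.{u + 1}
  id _ := PUnit.unit
  comp _ _ := PUnit.unit
  inv _ := PUnit.unit

/-- The connected groupoid with three objects and nine morphisms, as an object of `CP*[Rel]`. -/
def threeGroupoid : CPStarRel.{u} := ⟨ThreeObj.{u}⟩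

/-- The morphism `h : a ⟶ c` of the witnessing groupoid. -/
def threeH : GroupoidMor threeGroupoid.{u}.carrier := ⟨ThreeObj.a, ThreeObj.c, PUnit.unit⟩

/-- The endomorphism `{(x, x) | x ≠ h, x ≠ h⁻¹}` of the witnessing groupoid in `CP*[Rel]`. -/
def threeWitness : threeGroupoid.{u} ⟶ threeGroupoid.{u} where
  rel := {s | s.1 = s.2 ∧ s.1 ≠ threeH ∧ s.1 ≠ threeH.inv}
  respectsInverses := by
    rintro ⟨x, y, ⟨⟩⟩ k ⟨e, h₁, h₂⟩
    simp only at e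
    subst e
    refine ⟨⟨rfl, fun e => h₂ ?_, fun e => h₁ ?_⟩, ⟨rfl, fun e => ?_, fun e => ?_⟩⟩
    · exact congrArg GroupoidMor.inv e
    · exact congrArg GroupoidMor.inv e
    · have e₁ : x = ThreeObj.a := congrArg GroupoidMor.dom e
      have e₂ : x = ThreeObj.c := congrArg GroupoidMor.cod e
      rw [e₁] at e₂
      cases e₂
    · have e₁ : x = ThreeObj.c := congrArg GroupoidMor.dom e
      have e₂ : x = ThreeObj.a := congrArg GroupoidMor.cod e
      rw [e₁] at e₂
      cases e₂

/-! The invariant is whether all dagger idempotents dagger split. `Split†` has this property by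
construction, and a dagger equivalence transports it (`DaggerEquivalent.daggerSplits`), so one
non-splitting dagger idempotent in `CP*[Rel]` suffices. The witness deletes `h : a ⟶ c` and its
inverse but keeps `a ⟶ b` and `b ⟶ c`. A splitting would identify the remaining seven morphisms with
all morphisms of a groupoid, compatibly with inverses and domain identities. There the images of `a
⟶ b` and `b ⟶ c` are composable, and their composite could only come from a morphism `a ⟶ c`, which
has been deleted. Relations in `CP*[Rel]` see endpoints but not composition, so the deletion is
still a legitimate morphism. -/

/-! ### Dagger splittings and their invariance under dagger equivalence -/

open DaggerCategory in
/-- Every dagger idempotent of `Split†[C]` dagger splits. -/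
theorem DaggerSplit.daggerSplits {C : Type u} [Category.{v} C] [DaggerCategory C]
    {P : DaggerSplit C} {e : P ⟶ P} (he : IsDaggerIdempotent e) : DaggerSplits e := by
  have h₁ : dag e.f = e.f := congrArg Hom.f he.1
  have h₂ : e.f ≫ e.f = e.f := congrArg Hom.f he.2
  -- The identity of `Q` is `e.f` itself, so both splitting equations reduce to `e† ∘ e = e`.
  let Q : DaggerSplit C := ⟨P.X, e.f, h₁, h₂⟩
  let f : P ⟶ Q := ⟨e.f, by
    change e.f = P.p ≫ e.f ≫ e.f
    rw [h₂, e.p_comp]⟩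
  refine ⟨Q, f, Hom.ext ?_, Hom.ext ?_⟩
  · change e.f ≫ dag e.f = e.f
    rw [h₁, h₂]
  · change dag e.f ≫ e.f = e.f
    rw [h₁, h₂]

open DaggerCategory in
/-- Splitting of all dagger idempotents is transported backwards along a dagger equivalence. -/
theorem DaggerEquivalent.daggerSplits {C : Type u} [Category.{v} C] [DaggerCategory C]
    {D : Type u'} [Category.{v'} D] [DaggerCategory D] (h : DaggerEquivalent C D)
    (hD : ∀ {Y : D} {q : Y ⟶ Y}, IsDaggerIdempotent q → DaggerSplits q)
    {X : C} {p : X ⟶ X} (hp : IsDaggerIdempotent p) : DaggerSplits p := by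
  obtain ⟨F, G, η, -, hF, hG, hη, -⟩ := h
  have hq : IsDaggerIdempotent (F.map p) :=
    ⟨by rw [← hF, hp.1], by rw [← F.map_comp, hp.2]⟩
  obtain ⟨Y, f, hf₁, hf₂⟩ := hD hq
  obtain ⟨hu₁, hu₂⟩ := hη X
  have nat : G.map (F.map p) ≫ η.hom.app X = η.hom.app X ≫ p := η.hom.naturality p
  -- The image under `G` of the splitting of `F.map p`, precomposed with the unitary `X ⟶ G (F X)`.
  refine ⟨G.obj Y, dag (η.hom.app X) ≫ G.map f, ?_, ?_⟩
  · calc (dag (η.hom.app X) ≫ G.map f) ≫ dag (dag (η.hom.app X) ≫ G.map f)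
        = dag (η.hom.app X) ≫ G.map (f ≫ dag f) ≫ η.hom.app X := by
          rw [dag_comp, dag_dag, ← hG, G.map_comp]
          simp only [Category.assoc]
      _ = p := by
          rw [hf₁, nat, ← Category.assoc, hu₂]
          exact Category.id_comp p
  · calc dag (dag (η.hom.app X) ≫ G.map f) ≫ dag (η.hom.app X) ≫ G.map f
        = G.map (dag f) ≫ (η.hom.app X ≫ dag (η.hom.app X)) ≫ G.map f := by
          rw [dag_comp, dag_dag, ← hG]
          simp only [Category.assoc]
      _ = 𝟙 (G.obj Y) := by
          rw [hu₁]
          erw [Category.id_comp (G.map f)]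
          rw [← G.map_comp, hf₂, G.map_id]

/-! ### The dagger idempotent that does not split -/

/-- Morphisms of the witnessing groupoid are pairs of objects. -/
def threeMorEquiv : GroupoidMor ThreeObj.{u} ≃ ThreeObj.{u} × ThreeObj.{u} where
  toFun g := (g.dom, g.cod)
  invFun x := ⟨x.1, x.2, PUnit.unit⟩
  left_inv := by rintro ⟨x, y, ⟨⟩⟩; rfl
  right_inv _ := rfl

theorem natCard_threeObj : Nat.card ThreeObj.{u} = 3 := by
  let e : ThreeObj.{u} ≃ Fin 3 :=
    { toFun := fun x => match x with | .a => 0 | .b => 1 | .c => 2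
      invFun := ![.a, .b, .c]
      left_inv := by rintro ⟨⟩ <;> rfl
      right_inv := by intro i; fin_cases i <;> rfl }
  rw [Nat.card_congr e, Nat.card_fin]

theorem mem_threeWitness {x y : GroupoidMor threeGroupoid.{u}.carrier} :
    (x, y) ∈ threeWitness.rel ↔ x = y ∧ x ≠ threeH ∧ x ≠ threeH.inv :=
  Iff.rfl

theorem isDaggerIdempotent_threeWitness :
    DaggerCategory.IsDaggerIdempotent threeWitness.{u} := by
  constructor
  · refine CPStarRel.Hom.ext (Set.ext ?_)
    rintro ⟨x, y⟩
    change (y, x) ∈ threeWitness.rel ↔ _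
    rw [mem_threeWitness, mem_threeWitness]
    constructor <;> rintro ⟨rfl, h⟩ <;> exact ⟨rfl, h⟩
  · refine CPStarRel.Hom.ext (Set.ext ?_)
    rintro ⟨x, y⟩
    change (∃ z, (x, z) ∈ threeWitness.rel ∧ (z, y) ∈ threeWitness.rel) ↔ _
    simp only [mem_threeWitness]
    constructor
    · rintro ⟨_, ⟨rfl, h⟩, ⟨rfl, -⟩⟩
      exact ⟨rfl, h⟩
    · rintro ⟨rfl, h⟩
      exact ⟨x, ⟨rfl, h⟩, ⟨rfl, h⟩⟩

/-- A dagger splitting is a bijection from `Mor(G) \ {h, h⁻¹}` onto the morphisms of a groupoid that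
preserves domains and codomains, so the composite of the images of `a ⟶ b` and `b ⟶ c` has no
preimage. -/
theorem not_daggerSplits_threeWitness :
    ¬ DaggerCategory.DaggerSplits threeWitness.{u} := by
  rintro ⟨H, f, h₁, h₂⟩
  -- `r₁` says that `f` is injective, with domain everything except `h` and `h⁻¹`; `r₂` says that it
  -- is single-valued and surjective.
  have r₁ : ∀ x y, (∃ k, (x, k) ∈ f.rel ∧ (y, k) ∈ f.rel) ↔ (x = y ∧ x ≠ threeH ∧ x ≠ threeH.inv) :=
    fun x y => Set.ext_iff.1 (congrArg CPStarRel.Hom.rel h₁) (x, y)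
  have r₂ : ∀ k l, (∃ x, (x, k) ∈ f.rel ∧ (x, l) ∈ f.rel) ↔ k = l :=
    fun k l => Set.ext_iff.1 (congrArg CPStarRel.Hom.rel h₂) (k, l)
  have total : ∀ x, x ≠ threeH → x ≠ threeH.inv → ∃ k, (x, k) ∈ f.rel := fun x hx hx' =>
    let ⟨k, hk, _⟩ := (r₁ x x).2 ⟨rfl, hx, hx'⟩
    ⟨k, hk⟩
  obtain ⟨k, hk⟩ := total ⟨.a, .b, PUnit.unit⟩
    (fun e => nomatch (congrArg GroupoidMor.cod e : ThreeObj.b = .c))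
    (fun e => nomatch (congrArg GroupoidMor.dom e : ThreeObj.a = .c))
  obtain ⟨l, hl⟩ := total ⟨.b, .c, PUnit.unit⟩
    (fun e => nomatch (congrArg GroupoidMor.dom e : ThreeObj.b = .a))
    (fun e => nomatch (congrArg GroupoidMor.dom e : ThreeObj.b = .c))
  have hk' := f.respectsInverses _ _ hk
  have hl' := f.respectsInverses _ _ hl
  -- The identity of `b` is related to the identities of both `k.cod` and `l.dom`; single-valuedness
  -- makes them equal.
  have hkl : k.cod = l.dom := congrArg GroupoidMor.dom
    ((r₂ _ _).1 ⟨_, (f.respectsInverses _ _ hk'.1).2, hl'.2⟩)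
  obtain ⟨kd, kc, k⟩ := k
  obtain ⟨ld, lc, l⟩ := l
  obtain rfl : kc = ld := hkl
  obtain ⟨x, hx, -⟩ := (r₂ ⟨kd, lc, k ≫ l⟩ _).2 rfl
  have hx' := f.respectsInverses _ _ hx
  -- The identities of `x.dom` and of `a` are both related to the identity of `kd`, so injectivity
  -- applies; inverses give the codomain.
  have hdom : x.dom = ThreeObj.a :=
    congrArg GroupoidMor.dom ((r₁ _ _).1 ⟨_, hx'.2, hk'.2⟩).1
  have hcod : x.cod = ThreeObj.c :=
    congrArg GroupoidMor.dom
      ((r₁ _ _).1 ⟨_, (f.respectsInverses _ _ hx'.1).2, (f.respectsInverses _ _ hl'.1).2⟩).1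
  refine ((r₁ x x).1 ⟨_, hx, hx⟩).2.1 ?_
  exact threeMorEquiv.injective (Prod.ext hdom hcod)

/-- Nine morphisms spread over nine nonempty hom-sets leave exactly one in each, so the counts pin
down the groupoid of the statement. -/
theorem mainTheorem2 :
    ¬ DaggerEquivalent CPStarRel.{u} (DaggerSplit CPMRel.{u}) ∧
      Nat.card threeGroupoid.{u}.carrier = 3 ∧
      Nat.card (GroupoidMor threeGroupoid.{u}.carrier) = 9 ∧
      (∀ x y : threeGroupoid.{u}.carrier, Nonempty (x ⟶ y)) ∧
      DaggerCategory.IsDaggerIdempotent threeWitness.{u} ∧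
      ¬ DaggerCategory.DaggerSplits threeWitness.{u} := by
  refine ⟨fun h => not_daggerSplits_threeWitness
      (h.daggerSplits DaggerSplit.daggerSplits isDaggerIdempotent_threeWitness),
    natCard_threeObj, ?_, fun _ _ => ⟨PUnit.unit⟩,
    isDaggerIdempotent_threeWitness, not_daggerSplits_threeWitness⟩
  refine (Nat.card_congr threeMorEquiv).trans ?_
  rw [Nat.card_prod, natCard_threeObj]
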